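/- **Setting and conventions.** Let $n=5$, let $J\subseteq\mathbb R$ be open, let $\xi:J\to\mathbb R$ be twice continuously differentiable, and consider, in coordinates $(t,z,\theta,\phi,\psi)$, the 5-dimensional interior black hole metric $$ds^2=-\Big(\tfrac{2\xi}{t^2}-1\Big)^{-1}dt^2+\Big(\tfrac{2\xi}{t^2}-1\Big)dz^2+t^2\big(d\theta^2+\sin^2\theta\,d\phi^2+\sin^2\theta\sin^2\phi\,d\psi^2\big),\qquad \xi=\xi(t),$$ at the points with $t\in J$, $t\ne0$, $2\xi(t)\ne t^2$, $\sin\theta\ne0$, $\sin\phi\neq 0$. Dots denote derivatives in $t$. Fix a sign $\varepsilon\in\{1,-1\}$ and let $\nabla$ be the Levi-Civita connection, $\mathcal R(X,Y)=\varepsilon\big([\nabla_X,\nabla_Y]-\nabla_{[X,Y]}\big)$, $S(X,Y)=\mathrm{tr}\{Z\mapsto\mathcal R(Z,X)Y\}$, $g(\mathcal LX,Y)=S(X,Y)$, $r=\mathrm{tr}\,\mathcal L$, and, for a $(0,2)$-tensor $A$, $(X\wedge_AY)Z=A(Y,Z)X-A(X,Z)Y$. Put $$\mathcal K(X,Y)=\mathcal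 R(X,Y)-\tfrac1{n-2}(X\wedge_g\mathcal LY+\mathcal LX\wedge_gY),\qquad \mathcal C(X,Y)=\mathcal K(X,Y)+\tfrac{r}{(n-1)(n-2)}X\wedge_gY,$$ $$\mathcal P(X,Y)=\mathcal R(X,Y)-\tfrac1{n-1}X\wedge_SY,\qquad \mathcal W(X,Y)=\mathcal R(X,Y)-\tfrac{r}{n(n-1)}X\wedge_gY,$$ and let $R,C,P,W,K$ be the $(0,4)$-tensors $D(X_1,X_2,X_3,X_4)=g(\mathcal D(X_1,X_2)X_3,X_4)$ for $\mathcal D=\mathcal R,\mathcal C,\mathcal P,\mathcal W,\mathcal K$; $G$ is the one for $\mathcal D(X,Y)=X\wedge_gY$. For a $(0,k)$-tensor $T$, $$(D\cdot T)(X_1,\dots,X_k;X,Y)=-\sum_{a=1}^kT(X_1,\dots,\mathcal D(X,Y)X_a,\dots,X_k),$$ and $Q(A,T)$ is given by the same formula with $\mathcal D(X,Y)$ replaced by $X\wedge_AY$. Finally $$(A\wedge B)(X_1,X_2,X,Y)=A(X_1,Y)B(X_2,X)+A(X_2,X)B(X_1,Y)-A(X_1,X)B(X_2,Y)-A(X_2,Y)B(X_1,X).$$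 **Theorem.** At all these points: (i) $R\cdot S=P\cdot S$; (ii) $R\cdot W-W\cdot R=-\varepsilon N_5\,Q(g,R)$; (iii) $C\cdot K-K\cdot C=-\varepsilon N_6\,Q(g,C)$; (iv) $C\cdot R-Q(S,C)=-\varepsilon N_7\,Q(g,C)$; (v) $R\cdot R-Q(S,R)=-\varepsilon N_8\,Q(g,C)$, where $12\xi-6t\dot\xi+t^2\ddot\xi\neq0$; (vi) $N_5N_9\,R\cdot W+N_1N_{10}\,Q(S,R)+N_1N_2N_8\,Q(S,W)=0$, where $12\xi-6t\dot\xi+t^2\ddot\xi\neq0$; (vii) $N_4\,R\cdot K+N_{11}\,K\cdot R+N_4\,Q(S,K)=0$; (viii) $N_2N_4N_8\,R\cdot K-N_1^2N_2\,K\cdot R+N_1N_2N_4\,Q(S,R)=0$, where $12\xi-6t\dot\xi+t^2\ddot\xi\neq0$; (ix) $N_3\,C\cdot W-N_7\,W\cdot C=N_3\,Q(S,C)$; (x) $N_3N_{12}\,C\cdot W+N_{10}\,W\cdot C=N_3N_2\,Q(S,W)$; (xi) $N_{13}\,C\cdot K+N_2N_{11}\,Q(S,C)+N_2^2\,Q(S,K)=0$;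 (xii) $N_4N_{10}\,W\cdot K+N_{12}N_{14}\,K\cdot W=N_4N_{14}\,Q(S,W)$; (xiii) $N_1N_4\,W\cdot K+N_3N_{11}\,K\cdot W+N_3N_4\,Q(S,K)=0$; (xiv) $R=-\varepsilon\frac{\phi}{2}\,S\wedge S+\mu\,g\wedge S-\varepsilon\eta\,G$, where $3\dot\xi-t\ddot\xi\ne0$. (For $\varepsilon=-1$ the factors $-\varepsilon$ are all $1$.) Here $$N_1=\tfrac{2\xi-t\dot\xi}{t^4},\quad N_2=\tfrac{12\xi-6t\dot\xi+t^2\ddot\xi}{6t^4},\quad N_3=\tfrac{20\xi-8t\dot\xi+t^2\ddot\xi}{10t^4},\quad N_4=\tfrac{6\xi-2t\dot\xi+t^2\ddot\xi}{3t^4},$$ $$N_5=-\tfrac{2\dot\xi+t\ddot\xi}{10t^3},\quad N_6=-\tfrac{2\dot\xi+t\ddot\xi}{6t^3},\quad N_7=\tfrac{4\xi+t^2\ddot\xi}{2t^4},\quad N_8=\tfrac{3(8\xi^2-4t\xi\dot\xi-t^2\dot\xi^2+2t^2\xi\ddot\xi)}{t^4(12\xi-6t\dot\xi+t^2\ddot\xi)},$$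 $$N_9=-\tfrac{3\dot\xi(4\xi-3t\dot\xi)+t\ddot\xi(4\xi+t\dot\xi)}{2t^7},\quad N_{10}=\tfrac{-80\xi^2+64t\xi\dot\xi-2t^2\dot\xi^2-4t^2\ddot\xi(2\xi+t\dot\xi)+t^4\ddot\xi^2}{20t^8},$$ $$N_{11}=\tfrac{-6\xi+6t\dot\xi+t^2\ddot\xi}{3t^4},\quad N_{12}=\tfrac{20\xi-16t\dot\xi-3t^2\ddot\xi}{10t^4},\quad N_{13}=\tfrac{6\dot\xi^2+5t\dot\xi\ddot\xi+t^2\ddot\xi^2}{6t^6},$$ $$N_{14}=\tfrac{240\xi^2-216t\xi\dot\xi+48t^2\dot\xi^2+32t^2\xi\ddot\xi-14t^3\dot\xi\ddot\xi+t^4\ddot\xi^2}{60t^8},$$ $$\phi=-\tfrac{t^2(12\xi+t(t\ddot\xi-6\dot\xi))}{(3\dot\xi-t\ddot\xi)^2},\quad \mu=-\tfrac{3\dot\xi(4\xi-3t\dot\xi)+t(4\xi+t\dot\xi)\ddot\xi}{t(3\dot\xi-t\ddot\xi)^2},\quad \eta=-\tfrac{2\left(-6t\dot\xi^3+\xi(9\dot\xi^2+2t\dot\xi\ddot\xi+t^2\ddot\xi^2)\right)}{t^4(3\dot\xi-t\ddot\xi)^2}$$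 (in (xiv), $\phi$ denotes this function and not the coordinate). -/

import Mathlib

noncomputable section

namespace SemiRiem

/-- Points of a coordinate domain of dimension `n`. -/
abbrev Coord (n : ℕ) := Fin n → ℝ

/-- Components of a `(0,k)`-tensor at a point, with respect to the coordinate basis. -/
abbrev CovTensor (n k : ℕ) := (Fin k → Fin n) → ℝ

/-- An endomorphism `𝒟(X,Y)` of the tangent space that depends on two tangent vectors `X, Y`:
`D u v l i` is the `l`-th component of `𝒟(∂_u, ∂_v) ∂_i`. -/
abbrev BiEnd (n : ℕ) := Fin n → Fin n → Matrix (Fin n) (Fin n) ℝ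

variable {n : ℕ}

/-- The partial derivative `∂f/∂x^i` at `x`. -/
def partialDeriv (i : Fin n) (f : Coord n → ℝ) (x : Coord n) : ℝ :=
  deriv (fun s => f (Function.update x i s)) (x i)

/-- The Christoffel symbol `Γ^l_{ij}` of the Levi-Civita connection of the metric with
components `g`. -/
def christoffel (g : Coord n → Matrix (Fin n) (Fin n) ℝ) (l i j : Fin n) (x : Coord n) : ℝ :=
  (1 / 2) * ∑ m, (g x)⁻¹ l m *
    (partialDeriv i (fun y => g y m j) x + partialDeriv j (fun y => g y m i) x
      - partialDeriv m (fun y => g y i j) x)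

/-- The curvature operator `[∇_X, ∇_Y] - ∇_{[X,Y]}` at `x`. -/
def curvOp (g : Coord n → Matrix (Fin n) (Fin n) ℝ) (x : Coord n) : BiEnd n := fun u v l i =>
  partialDeriv u (christoffel g l v i) x - partialDeriv v (christoffel g l u i) x
    + ∑ m, (christoffel g m v i x * christoffel g l u m x
        - christoffel g m u i x * christoffel g l v m x)

/-! ### Algebra at a point

`g` is the matrix of the metric at the point, `Rm` the curvature operator there. -/

/-- A `(0,2)`-tensor given by its matrix. -/
def ofMatrix (A : Matrix (Fin n) (Fin n) ℝ) : CovTensor n 2 := fun I => A (I 0) (I 1)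

/-- The coordinate vector `∂_u`. -/
def basisVec (u : Fin n) : Fin n → ℝ := Pi.single u 1

/-- The endomorphism `X ∧_A Y`, `Z ↦ A(Y,Z) X - A(X,Z) Y`. -/
def wedgeEnd (A : Matrix (Fin n) (Fin n) ℝ) (X Y : Fin n → ℝ) : Matrix (Fin n) (Fin n) ℝ :=
  fun l i => (∑ j, Y j * A j i) * X l - (∑ j, X j * A j i) * Y l

/-- The Ricci tensor `S(X,Y) = tr (Z ↦ Rm(Z,X)Y)`. -/
def ricci (Rm : BiEnd n) : Matrix (Fin n) (Fin n) ℝ := fun i j => ∑ h, Rm h i h j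

/-- The Ricci operator `ℒ`, determined by `g(ℒX,Y) = S(X,Y)`. -/
def ricciOp (g : Matrix (Fin n) (Fin n) ℝ) (Rm : BiEnd n) : Matrix (Fin n) (Fin n) ℝ :=
  fun l i => ∑ m, g⁻¹ l m * ricci Rm i m

/-- The scalar curvature `r = tr ℒ`. -/
def scalarCurv (g : Matrix (Fin n) (Fin n) ℝ) (Rm : BiEnd n) : ℝ := (ricciOp g Rm).trace

/-- The Weyl conformal curvature operator. -/
def conformalOp (g : Matrix (Fin n) (Fin n) ℝ) (Rm : BiEnd n) : BiEnd n := fun u v =>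
  Rm u v - (1 / ((n : ℝ) - 2)) •
    (wedgeEnd g (basisVec u) ((ricciOp g Rm).mulVec (basisVec v))
      + wedgeEnd g ((ricciOp g Rm).mulVec (basisVec u)) (basisVec v)
      - (scalarCurv g Rm / ((n : ℝ) - 1)) • wedgeEnd g (basisVec u) (basisVec v))

/-- The projective curvature operator. -/
def projectiveOp (Rm : BiEnd n) : BiEnd n := fun u v =>
  Rm u v - (1 / ((n : ℝ) - 1)) • wedgeEnd (ricci Rm) (basisVec u) (basisVec v)

/-- The concircular curvature operator. -/
def concircularOp (g : Matrix (Fin n) (Fin n) ℝ) (Rm : BiEnd n) : BiEnd n := fun u v =>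
  Rm u v - (scalarCurv g Rm / ((n : ℝ) * ((n : ℝ) - 1))) • wedgeEnd g (basisVec u) (basisVec v)

/-- The conharmonic curvature operator. -/
def conharmonicOp (g : Matrix (Fin n) (Fin n) ℝ) (Rm : BiEnd n) : BiEnd n := fun u v =>
  Rm u v - (1 / ((n : ℝ) - 2)) •
    (wedgeEnd g (basisVec u) ((ricciOp g Rm).mulVec (basisVec v))
      + wedgeEnd g ((ricciOp g Rm).mulVec (basisVec u)) (basisVec v))

/-- The `(0,4)`-tensor `D(X₁,X₂,X₃,X₄) = g(𝒟(X₁,X₂)X₃, X₄)`. -/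
def lower (g : Matrix (Fin n) (Fin n) ℝ) (D : BiEnd n) : CovTensor n 4 := fun I =>
  ∑ l, D (I 0) (I 1) l (I 2) * g l (I 3)

/-- The Kulkarni-Nomizu product `A ∧ B`. -/
def kulkarniNomizu (A B : Matrix (Fin n) (Fin n) ℝ) : CovTensor n 4 := fun I =>
  A (I 0) (I 3) * B (I 1) (I 2) + A (I 1) (I 2) * B (I 0) (I 3)
    - A (I 0) (I 2) * B (I 1) (I 3) - A (I 1) (I 3) * B (I 0) (I 2)

/-- The tensor `G(X₁,X₂,X₃,X₄) = g((X₁ ∧_g X₂)X₃, X₄)`. -/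
def tensorG (g : Matrix (Fin n) (Fin n) ℝ) : CovTensor n 4 :=
  lower g (fun u v => wedgeEnd g (basisVec u) (basisVec v))

/-- The `(0,k+2)`-tensor `D · T`:
`(D · T)(X₁,…,X_k; X,Y) = - ∑ₐ T(X₁,…,𝒟(X,Y)Xₐ,…,X_k)`; the last two arguments are `X, Y`. -/
def dot {k : ℕ} (D : BiEnd n) (T : CovTensor n k) :
    (Fin k → Fin n) → Fin n → Fin n → ℝ := fun I u v =>
  -∑ a, ∑ p, D u v p (I a) * T (Function.update I a p)

/-- The Tachibana tensor `Q(A,T)(X₁,…,X_k; X,Y) = ((X ∧_A Y) · T)(X₁,…,X_k)`. -/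
def tachibana {k : ℕ} (A : Matrix (Fin n) (Fin n) ℝ) (T : CovTensor n k) :
    (Fin k → Fin n) → Fin n → Fin n → ℝ :=
  dot (fun u v => wedgeEnd A (basisVec u) (basisVec v)) T

end SemiRiem

open SemiRiem

/-- The 5-dimensional interior black hole metric in the coordinates
`x = (t, z, θ, φ, ψ)`. -/
def interiorMetric (ξ : ℝ → ℝ) (x : Coord 5) : Matrix (Fin 5) (Fin 5) ℝ :=
  Matrix.diagonal ![
    -(2 * ξ (x 0) / (x 0) ^ 2 - 1)⁻¹,
    2 * ξ (x 0) / (x 0) ^ 2 - 1,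
    (x 0) ^ 2,
    (x 0) ^ 2 * Real.sin (x 2) ^ 2,
    (x 0) ^ 2 * (Real.sin (x 2) ^ 2 * Real.sin (x 3) ^ 2)]

end

open SemiRiem

open SemiRiem

/-! The metric is a warped product of the `(t, z)` plane with a round 3-sphere, and the Hessian of
the warping function `t` is a multiple of the base metric. Its curvature operator is therefore
`κ(u,v) ∂_u ∧_g ∂_v`, where `κ` takes only three values: `a` on the base, `b` on mixed pairs and `c`
on the fibre. With `h = 2ξ/t² - 1` these are `a = h''/2`, `b = h'/(2t)`, `c = (1 + h)/t²`, each
multiplied by `ε` for `R`. This is `curvOp_interiorMetric`.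

The family `blockOp γ a b c` contains all the operators needed except `𝒫`. The Ricci operator is
scalar on each block, so `X ∧_g ℒY + ℒX ∧_g Y` only rescales coordinate wedges, and the Weyl,
concircular and conharmonic operators differ from `R` by changed values of `a`, `b`, `c`.
Kulkarni-Nomizu products of forms that are scalar on the blocks belong to the same family.

The decisive point is `dot_blockOp` together with `tachibana_blockForm`: every `D · T` and `Q(A, T)`
in this family is a combination of the same two tensors `mixedLow` and `mixedHigh`, because pairs
inside one block act trivially. Each of (ii)-(xiii) thus follows from two scalar identities in `t`,
`ξ` and its derivatives, and (xiv) from three, one for each block value. Identity (i) is separate: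
it is the vanishing of `Q(S, S)`. -/

namespace InteriorBH

/-! ### The lapse, the diagonal metric and their derivatives -/

/-- The function `2ξ/t² - 1`. -/
noncomputable def lapse (ξ : ℝ → ℝ) (t : ℝ) : ℝ := 2 * ξ t / t ^ 2 - 1

/-- The derivative of `lapse ξ`. -/
noncomputable def lapse' (ξ : ℝ → ℝ) (t : ℝ) : ℝ := 2 * deriv ξ t / t ^ 2 - 4 * ξ t / t ^ 3

/-- The second derivative of `lapse ξ`. -/
noncomputable def lapse'' (ξ : ℝ → ℝ) (t : ℝ) : ℝ :=
  2 * deriv (deriv ξ) t / t ^ 2 - 8 * deriv ξ t / t ^ 3 + 12 * ξ t / t ^ 4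

theorem hasDerivAt_lapse {ξ : ℝ → ℝ} {t : ℝ} (hd : DifferentiableAt ℝ ξ t) (ht : t ≠ 0) :
    HasDerivAt (lapse ξ) (lapse' ξ t) t := by
  have h := ((hd.hasDerivAt.const_mul 2).div (hasDerivAt_pow 2 t) (pow_ne_zero 2 ht)).sub_const 1
  refine h.congr_deriv ?_
  unfold lapse'
  field_simp
  push_cast
  ring

theorem hasDerivAt_lapse' {ξ : ℝ → ℝ} {t : ℝ} (hd : DifferentiableAt ℝ ξ t)
    (hd' : DifferentiableAt ℝ (deriv ξ) t) (ht : t ≠ 0) :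
    HasDerivAt (lapse' ξ) (lapse'' ξ t) t := by
  have h := ((hd'.hasDerivAt.const_mul 2).div (hasDerivAt_pow 2 t) (pow_ne_zero 2 ht)).sub
    ((hd.hasDerivAt.const_mul 4).div (hasDerivAt_pow 3 t) (pow_ne_zero 3 ht))
  refine h.congr_deriv ?_
  unfold lapse''
  field_simp
  push_cast
  ring

/-- The diagonal entries of the metric. -/
noncomputable def metricDiag (ξ : ℝ → ℝ) (x : Coord 5) : Fin 5 → ℝ :=
  ![-(lapse ξ (x 0))⁻¹, lapse ξ (x 0), x 0 ^ 2, x 0 ^ 2 * Real.sin (x 2) ^ 2,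
    x 0 ^ 2 * (Real.sin (x 2) ^ 2 * Real.sin (x 3) ^ 2)]

/-- The first partial derivatives of the metric: row `i` holds the `i`-th partial derivatives of
the diagonal entries. -/
noncomputable def metricDiagDeriv (ξ : ℝ → ℝ) (x : Coord 5) : Matrix (Fin 5) (Fin 5) ℝ :=
  !![lapse' ξ (x 0) / lapse ξ (x 0) ^ 2, lapse' ξ (x 0), 2 * x 0, 2 * x 0 * Real.sin (x 2) ^ 2,
      2 * x 0 * (Real.sin (x 2) ^ 2 * Real.sin (x 3) ^ 2);
    0, 0, 0, 0, 0;
    0, 0, 0, x 0 ^ 2 * (2 * Real.sin (x 2) * Real.cos (x 2)),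
      x 0 ^ 2 * (2 * Real.sin (x 2) * Real.cos (x 2) * Real.sin (x 3) ^ 2);
    0, 0, 0, 0, x 0 ^ 2 * (Real.sin (x 2) ^ 2 * (2 * Real.sin (x 3) * Real.cos (x 3)));
    0, 0, 0, 0, 0]

theorem hasDerivAt_sin_sq (s : ℝ) :
    HasDerivAt (fun s => Real.sin s ^ 2) (2 * Real.sin s * Real.cos s) s := by
  simpa using (Real.hasDerivAt_sin s).fun_pow 2

theorem partialDeriv_metricDiag {ξ : ℝ → ℝ} {x : Coord 5} (hd : DifferentiableAt ℝ ξ (x 0))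
    (ht : x 0 ≠ 0) (hl : lapse ξ (x 0) ≠ 0) (i m : Fin 5) :
    partialDeriv i (fun y => metricDiag ξ y m) x = metricDiagDeriv ξ x i m := by
  have hL := hasDerivAt_lapse hd ht
  have h1 : deriv (fun s => (lapse ξ s)⁻¹) (x 0) = -lapse' ξ (x 0) / lapse ξ (x 0) ^ 2 :=
    (hL.fun_inv hl).deriv
  have h2 : deriv (fun s => lapse ξ s) (x 0) = lapse' ξ (x 0) := hL.deriv
  have h3 : deriv (fun s : ℝ => s ^ 2) (x 0) = 2 * x 0 := by simp
  have h4 : ∀ s, deriv (fun s => Real.sin s ^ 2) s = 2 * Real.sin s * Real.cos s :=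
    fun s => (hasDerivAt_sin_sq s).deriv
  unfold partialDeriv
  fin_cases i <;> fin_cases m <;>
    simp [metricDiag, metricDiagDeriv, h1, h2, h3, h4, neg_div, -deriv_fun_pow]

theorem inv_diagonal {n : ℕ} {d : Fin n → ℝ} (hd : ∀ i, d i ≠ 0) :
    (Matrix.diagonal d)⁻¹ = Matrix.diagonal fun i => (d i)⁻¹ := by
  refine Matrix.inv_eq_right_inv ?_
  rw [Matrix.diagonal_mul_diagonal, ← Matrix.diagonal_one]
  congr 1
  funext i
  exact mul_inv_cancel₀ (hd i)

/-! ### Christoffel symbols and their partial derivatives -/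

/-- The Christoffel symbols of a diagonal metric. -/
theorem christoffel_diagonal {n : ℕ} {d : Coord n → Fin n → ℝ} {x : Coord n}
    (hx : ∀ i, d x i ≠ 0) (l i j : Fin n) :
    christoffel (fun y => Matrix.diagonal (d y)) l i j x =
      1 / 2 * ((d x l)⁻¹ * ((if l = j then partialDeriv i (fun y => d y l) x else 0)
        + (if l = i then partialDeriv j (fun y => d y l) x else 0)
        - (if i = j then partialDeriv l (fun y => d y i) x else 0))) := by
  have hinv := inv_diagonal hx
  have hp : ∀ i m j : Fin n, partialDeriv i (fun y => Matrix.diagonal (d y) m j) x =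
      if m = j then partialDeriv i (fun y => d y m) x else 0 := by
    intro i m j
    by_cases h : m = j
    · subst h
      simp
    · simp [h, partialDeriv]
  unfold christoffel
  rw [hinv, Finset.sum_eq_single l]
  · simp only [hp, Matrix.diagonal_apply_eq]
  · intro m _ hm
    rw [Matrix.diagonal_apply_ne _ (Ne.symm hm), zero_mul]
  · simp

/-- The Christoffel symbols as functions of the lapse `h`, its derivative `p` and the coordinates
`t`, `θ`, `φ`. -/
noncomputable def christoffelTable (h p t θ φ : ℝ) : Fin 5 → Matrix (Fin 5) (Fin 5) ℝ :=
  ![Matrix.diagonal ![-(p / (2 * h)), h * p / 2, h * t, h * t * Real.sin θ ^ 2,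
      h * t * (Real.sin θ ^ 2 * Real.sin φ ^ 2)],
    !![0, p / (2 * h), 0, 0, 0; p / (2 * h), 0, 0, 0, 0; 0, 0, 0, 0, 0; 0, 0, 0, 0, 0;
      0, 0, 0, 0, 0],
    !![0, 0, t⁻¹, 0, 0; 0, 0, 0, 0, 0; t⁻¹, 0, 0, 0, 0; 0, 0, 0, -(Real.sin θ * Real.cos θ), 0;
      0, 0, 0, 0, -(Real.sin θ * Real.cos θ * Real.sin φ ^ 2)],
    !![0, 0, 0, t⁻¹, 0; 0, 0, 0, 0, 0; 0, 0, 0, Real.cos θ / Real.sin θ, 0;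
      t⁻¹, 0, Real.cos θ / Real.sin θ, 0, 0; 0, 0, 0, 0, -(Real.sin φ * Real.cos φ)],
    !![0, 0, 0, 0, t⁻¹; 0, 0, 0, 0, 0; 0, 0, 0, 0, Real.cos θ / Real.sin θ;
      0, 0, 0, 0, Real.cos φ / Real.sin φ;
      t⁻¹, 0, Real.cos θ / Real.sin θ, Real.cos φ / Real.sin φ, 0]]

/-- The derivatives of the Christoffel symbols with respect to `t`; `q` is the second derivative of
the lapse. -/
noncomputable def christoffelDerivT (h p q t θ φ : ℝ) : Fin 5 → Matrix (Fin 5) (Fin 5) ℝ :=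
  ![Matrix.diagonal ![-((q * h - p ^ 2) / (2 * h ^ 2)), (p ^ 2 + h * q) / 2, p * t + h,
      (p * t + h) * Real.sin θ ^ 2, (p * t + h) * (Real.sin θ ^ 2 * Real.sin φ ^ 2)],
    !![0, (q * h - p ^ 2) / (2 * h ^ 2), 0, 0, 0; (q * h - p ^ 2) / (2 * h ^ 2), 0, 0, 0, 0;
      0, 0, 0, 0, 0; 0, 0, 0, 0, 0; 0, 0, 0, 0, 0],
    !![0, 0, -(t ^ 2)⁻¹, 0, 0; 0, 0, 0, 0, 0; -(t ^ 2)⁻¹, 0, 0, 0, 0; 0, 0, 0, 0, 0;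
      0, 0, 0, 0, 0],
    !![0, 0, 0, -(t ^ 2)⁻¹, 0; 0, 0, 0, 0, 0; 0, 0, 0, 0, 0; -(t ^ 2)⁻¹, 0, 0, 0, 0;
      0, 0, 0, 0, 0],
    !![0, 0, 0, 0, -(t ^ 2)⁻¹; 0, 0, 0, 0, 0; 0, 0, 0, 0, 0; 0, 0, 0, 0, 0;
      -(t ^ 2)⁻¹, 0, 0, 0, 0]]

/-- The derivatives of the Christoffel symbols with respect to `θ`. -/
noncomputable def christoffelDerivTheta (h t θ φ : ℝ) : Fin 5 → Matrix (Fin 5) (Fin 5) ℝ :=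
  ![Matrix.diagonal ![0, 0, 0, h * t * (2 * Real.sin θ * Real.cos θ),
      h * t * (2 * Real.sin θ * Real.cos θ * Real.sin φ ^ 2)],
    Matrix.diagonal ![0, 0, 0, 0, 0],
    Matrix.diagonal ![0, 0, 0, Real.sin θ ^ 2 - Real.cos θ ^ 2,
      (Real.sin θ ^ 2 - Real.cos θ ^ 2) * Real.sin φ ^ 2],
    !![0, 0, 0, 0, 0; 0, 0, 0, 0, 0; 0, 0, 0, -(Real.sin θ ^ 2)⁻¹, 0;
      0, 0, -(Real.sin θ ^ 2)⁻¹, 0, 0; 0, 0, 0, 0, 0],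
    !![0, 0, 0, 0, 0; 0, 0, 0, 0, 0; 0, 0, 0, 0, -(Real.sin θ ^ 2)⁻¹;
      0, 0, 0, 0, 0; 0, 0, -(Real.sin θ ^ 2)⁻¹, 0, 0]]

/-- The derivatives of the Christoffel symbols with respect to `φ`. -/
noncomputable def christoffelDerivPhi (h t θ φ : ℝ) : Fin 5 → Matrix (Fin 5) (Fin 5) ℝ :=
  ![Matrix.diagonal ![0, 0, 0, 0, h * t * (Real.sin θ ^ 2 * (2 * Real.sin φ * Real.cos φ))],
    Matrix.diagonal ![0, 0, 0, 0, 0],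
    Matrix.diagonal ![0, 0, 0, 0, -(Real.sin θ * Real.cos θ * (2 * Real.sin φ * Real.cos φ))],
    Matrix.diagonal ![0, 0, 0, 0, Real.sin φ ^ 2 - Real.cos φ ^ 2],
    !![0, 0, 0, 0, 0; 0, 0, 0, 0, 0; 0, 0, 0, 0, 0; 0, 0, 0, 0, -(Real.sin φ ^ 2)⁻¹;
      0, 0, 0, -(Real.sin φ ^ 2)⁻¹, 0]]

/-- The partial derivatives of the Christoffel symbols, the first index being the one of the
derivative. -/
noncomputable def christoffelDerivTable (h p q t θ φ : ℝ) :
    Fin 5 → Fin 5 → Matrix (Fin 5) (Fin 5) ℝ :=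
  ![christoffelDerivT h p q t θ φ, 0, christoffelDerivTheta h t θ φ, christoffelDerivPhi h t θ φ, 0]

theorem metricDiag_ne_zero {ξ : ℝ → ℝ} {x : Coord 5} (ht : x 0 ≠ 0) (hl : lapse ξ (x 0) ≠ 0)
    (hθ : Real.sin (x 2) ≠ 0) (hφ : Real.sin (x 3) ≠ 0) (i : Fin 5) : metricDiag ξ x i ≠ 0 := by
  fin_cases i <;> simp [metricDiag, ht, hl, hθ, hφ]

theorem christoffel_interiorMetric {ξ : ℝ → ℝ} {x : Coord 5} (hd : DifferentiableAt ℝ ξ (x 0))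
    (ht : x 0 ≠ 0) (hl : lapse ξ (x 0) ≠ 0) (hθ : Real.sin (x 2) ≠ 0) (hφ : Real.sin (x 3) ≠ 0)
    (l i j : Fin 5) :
    christoffel (interiorMetric ξ) l i j x =
      christoffelTable (lapse ξ (x 0)) (lapse' ξ (x 0)) (x 0) (x 2) (x 3) l i j := by
  have h := christoffel_diagonal (metricDiag_ne_zero ht hl hθ hφ) l i j
  simp only [partialDeriv_metricDiag hd ht hl] at h
  refine h.trans ?_
  fin_cases l <;> fin_cases i <;> fin_cases j <;>
    simp [metricDiag, metricDiagDeriv, christoffelTable] <;> try field_simp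

/-- The closed form of the Christoffel symbols holds only where the metric is nondegenerate, so it
can be differentiated only as a local equality. -/
theorem partialDeriv_congr {n : ℕ} {f g : Coord n → ℝ} {x : Coord n} (h : f =ᶠ[nhds x] g)
    (i : Fin n) : partialDeriv i f x = partialDeriv i g x := by
  have hc : Filter.Tendsto (fun s => Function.update x i s) (nhds (x i)) (nhds x) := by
    have := (continuous_const.update i continuous_id : Continuous fun s : ℝ =>
      Function.update x i s).tendsto (x i)
    simpa using this
  exact Filter.EventuallyEq.deriv_eq (hc.eventually h)

theorem hasDerivAt_cot {s : ℝ} (hs : Real.sin s ≠ 0) :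
    HasDerivAt (fun s => Real.cos s / Real.sin s) (-(Real.sin s ^ 2)⁻¹) s := by
  refine ((Real.hasDerivAt_cos s).fun_div (Real.hasDerivAt_sin s) hs).congr_deriv ?_
  field_simp
  linear_combination -(Real.sin_sq_add_cos_sq s)

theorem hasDerivAt_sin_mul_cos (s : ℝ) :
    HasDerivAt (fun s => Real.sin s * Real.cos s) (Real.cos s ^ 2 - Real.sin s ^ 2) s := by
  refine ((Real.hasDerivAt_sin s).fun_mul (Real.hasDerivAt_cos s)).congr_deriv ?_
  ring

set_option maxHeartbeats 1000000 in
theorem partialDeriv_christoffelTable {ξ : ℝ → ℝ} {x : Coord 5}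
    (hd : DifferentiableAt ℝ ξ (x 0)) (hd' : DifferentiableAt ℝ (deriv ξ) (x 0))
    (ht : x 0 ≠ 0) (hl : lapse ξ (x 0) ≠ 0) (hθ : Real.sin (x 2) ≠ 0) (hφ : Real.sin (x 3) ≠ 0)
    (u l i j : Fin 5) :
    partialDeriv u (fun y =>
        christoffelTable (lapse ξ (y 0)) (lapse' ξ (y 0)) (y 0) (y 2) (y 3) l i j) x =
      christoffelDerivTable (lapse ξ (x 0)) (lapse' ξ (x 0)) (lapse'' ξ (x 0)) (x 0) (x 2) (x 3)
        u l i j := by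
  have hL := hasDerivAt_lapse hd ht
  have hL' := hasDerivAt_lapse' hd hd' ht
  have h1 : deriv (fun s => lapse' ξ s / (2 * lapse ξ s)) (x 0) =
      (lapse'' ξ (x 0) * lapse ξ (x 0) - lapse' ξ (x 0) ^ 2) / (2 * lapse ξ (x 0) ^ 2) := by
    rw [(hL'.fun_div (hL.const_mul 2) (mul_ne_zero two_ne_zero hl)).deriv]
    field_simp
  have h2 : deriv (fun s => lapse ξ s * lapse' ξ s) (x 0) =
      lapse' ξ (x 0) ^ 2 + lapse ξ (x 0) * lapse'' ξ (x 0) := by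
    rw [(hL.fun_mul hL').deriv]
    ring
  have h3 : deriv (fun s => lapse ξ s * s) (x 0) = lapse' ξ (x 0) * x 0 + lapse ξ (x 0) := by
    rw [(hL.fun_mul (hasDerivAt_id' _)).deriv]
    ring
  have h4 : ∀ s, deriv (fun s => Real.sin s ^ 2) s = 2 * Real.sin s * Real.cos s :=
    fun s => (hasDerivAt_sin_sq s).deriv
  have h5 : ∀ s, deriv (fun s => Real.sin s * Real.cos s) s =
    Real.cos s ^ 2 - Real.sin s ^ 2 := fun s => (hasDerivAt_sin_mul_cos s).deriv
  have h6 := (hasDerivAt_cot hθ).deriv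
  have h7 := (hasDerivAt_cot hφ).deriv
  unfold partialDeriv
  fin_cases u
  · change _ = christoffelDerivT _ _ _ _ _ _ l i j
    fin_cases l <;> fin_cases i <;> fin_cases j <;>
      simp [christoffelTable, christoffelDerivT, h1, h2, h3]
  · change _ = (0 : ℝ)
    simp
  · change _ = christoffelDerivTheta _ _ _ _ l i j
    fin_cases l <;> fin_cases i <;> fin_cases j <;>
      simp [christoffelTable, christoffelDerivTheta, h4, h5, h6, -deriv_fun_pow]
    ring
  · change _ = christoffelDerivPhi _ _ _ _ l i j
    fin_cases l <;> fin_cases i <;> fin_cases j <;>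
       simp [christoffelTable, christoffelDerivPhi, h4, h5, h7, -deriv_fun_pow]
  · change _ = (0 : ℝ)
    simp

/-! ### Block operators and their action on tensors -/

/-- The function of two indices that is constant on the blocks determined by the splitting
`{0, 1} ∪ {2, 3, 4}`. -/
def blockVal (a b c : ℝ) (i j : Fin 5) : ℝ :=
  if i < 2 then (if j < 2 then a else b) else (if j < 2 then b else c)

/-- The diagonal matrix with entries `s i * γ i`, `s` constant on `{0, 1}` and on `{2, 3, 4}`. -/
def blockForm (γ : Fin 5 → ℝ) (s s' : ℝ) : Matrix (Fin 5) (Fin 5) ℝ :=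
  Matrix.diagonal fun i => (if i < 2 then s else s') * γ i

/-- The operator `κ(u,v) ∂_u ∧_g ∂_v` for the diagonal form `g` with entries `γ`. -/
def blockOp (γ : Fin 5 → ℝ) (a b c : ℝ) : BiEnd 5 := fun u v =>
  blockVal a b c u v • wedgeEnd (Matrix.diagonal γ) (basisVec u) (basisVec v)

theorem wedgeEnd_diagonal (γ : Fin 5 → ℝ) (u v p i : Fin 5) :
    wedgeEnd (Matrix.diagonal γ) (basisVec u) (basisVec v) p i =
      (if v = i then γ v else 0) * (if p = u then 1 else 0)
        - (if u = i then γ u else 0) * (if p = v then 1 else 0) := by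
  simp [wedgeEnd, basisVec, Matrix.diagonal, Pi.single_apply, eq_comm]
  split_ifs <;> simp_all

/-- The action of `d X ∧_A Y` on a `(0,k)`-tensor for a diagonal form `A` with entries `γ`. -/
theorem dot_wedgeEnd {k : ℕ} (d : Fin 5 → Fin 5 → ℝ) (γ : Fin 5 → ℝ) (T : CovTensor 5 k)
    (I : Fin k → Fin 5) (u v : Fin 5) :
    dot (fun u v => d u v • wedgeEnd (Matrix.diagonal γ) (basisVec u) (basisVec v)) T I u v =
      d u v * ∑ a, ((if u = I a then γ u else 0) * T (Function.update I a v)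
        - (if v = I a then γ v else 0) * T (Function.update I a u)) := by
  unfold dot
  rw [Finset.mul_sum, ← Finset.sum_neg_distrib]
  refine Finset.sum_congr rfl fun a _ => ?_
  simp only [Matrix.smul_apply, wedgeEnd_diagonal, smul_eq_mul, mul_sub, sub_mul,
    Finset.sum_sub_distrib, mul_ite, ite_mul, mul_one, mul_zero, zero_mul,
    Finset.sum_ite_eq', Finset.mem_univ, if_true]
  split_ifs <;> ring

/-- The entries of the tensor of the operator `τ(u,v) ∂_u ∧_g ∂_v`. -/
theorem lower_wedgeEnd (τ : Fin 5 → Fin 5 → ℝ) (γ : Fin 5 → ℝ) (I : Fin 4 → Fin 5) :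
    lower (Matrix.diagonal γ)
        (fun u v => τ u v • wedgeEnd (Matrix.diagonal γ) (basisVec u) (basisVec v)) I =
      τ (I 0) (I 1) * ((if I 1 = I 2 then γ (I 1) else 0) * (if I 0 = I 3 then γ (I 0) else 0)
        - (if I 0 = I 2 then γ (I 0) else 0) * (if I 1 = I 3 then γ (I 1) else 0)) := by
  unfold lower
  rw [Finset.sum_eq_single (I 3)]
  · simp only [Matrix.smul_apply, wedgeEnd_diagonal, smul_eq_mul, Matrix.diagonal_apply_eq]
    simp only [eq_comm (a := I 3)]
    split_ifs <;> simp_all <;> ring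
  · intro b _ hb
    simp [Matrix.diagonal_apply_ne _ hb]
  · simp

/-- The `(0,4)`-tensor with diagonal pattern `X` from which the tensors `D · T` are built. -/
def mixedTensor (X : Fin 5 → ℝ) (I : Fin 4 → Fin 5) (u v : Fin 5) : ℝ :=
  let m : Fin 5 → Fin 5 → ℝ := fun i j =>
    (if u = i then 1 else 0) * (if v = j then 1 else 0)
      + (if v = i then 1 else 0) * (if u = j then 1 else 0)
  (if I 1 = I 2 then X (I 1) else 0) * m (I 0) (I 3)
    + (if I 0 = I 3 then X (I 0) else 0) * m (I 1) (I 2)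
    - (if I 1 = I 3 then X (I 1) else 0) * m (I 0) (I 2)
    - (if I 0 = I 2 then X (I 0) else 0) * m (I 1) (I 3)

/-- A component of the action can survive only if two slots carry `u` and `v` and the other two
share an index `w`. Moving `u` to `v` and `v` to `u` contributes opposite terms, which leaves the
difference `s u * τ v w - s v * τ u w`. Taking `s = 1` gives `D · T`, and `d = 1` gives `Q(A, T)`.
-/
theorem dot_lower (d τ : Fin 5 → Fin 5 → ℝ) (hτ : ∀ i j, τ i j = τ j i) (s γ : Fin 5 → ℝ)
    (I : Fin 4 → Fin 5) (u v : Fin 5) :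
    dot (fun u v => d u v •
          wedgeEnd (Matrix.diagonal fun i => s i * γ i) (basisVec u) (basisVec v))
        (lower (Matrix.diagonal γ) fun u v =>
          τ u v • wedgeEnd (Matrix.diagonal γ) (basisVec u) (basisVec v)) I u v =
      mixedTensor (fun w => d u v * (γ u * γ v * γ w * (s u * τ v w - s v * τ u w))) I u v := by
  rw [dot_wedgeEnd]
  obtain ⟨i, j, k, l, rfl⟩ : ∃ i j k l, I = ![i, j, k, l] :=
    ⟨I 0, I 1, I 2, I 3, by ext a; fin_cases a <;> rfl⟩
  simp only [lower_wedgeEnd, Fin.sum_univ_four, mixedTensor]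
  have hδ : ∀ (a b : Fin 5) (c : ℝ), (if a = b then c else 0) = (if a = b then 1 else 0) * c := by
    intro a b c
    split_ifs <;> simp
  have hsymm : ∀ a b : Fin 5, (if a = b then (1 : ℝ) else 0) = if b = a then 1 else 0 := by
    intro a b
    simp only [eq_comm]
  -- Replacing slots 2 and 3 leaves `τ i j` untouched, while the target has `u` or `v` among the
  -- arguments of `τ`; the Kronecker delta permits the exchange.
  have hE : ∀ w a b : Fin 5, (if w = a then (1 : ℝ) else 0) * (τ a b * γ a) =
      (if w = a then 1 else 0) * (τ w b * γ w) := by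
    intro w a b
    split_ifs with h
    · rw [h]
    · simp
  have hu0 : ∀ w, Function.update ![i, j, k, l] 0 w = ![w, j, k, l] := fun w => by
    ext a; fin_cases a <;> rfl
  have hu1 : ∀ w, Function.update ![i, j, k, l] 1 w = ![i, w, k, l] := fun w => by
    ext a; fin_cases a <;> rfl
  have hu2 : ∀ w, Function.update ![i, j, k, l] 2 w = ![i, j, w, l] := fun w => by
    ext a; fin_cases a <;> rfl
  have hu3 : ∀ w, Function.update ![i, j, k, l] 3 w = ![i, j, k, w] := fun w => by
    ext a; fin_cases a <;> rfl
  have c0 : ∀ a b c e : Fin 5, ![a, b, c, e] 0 = a := fun _ _ _ _ => rfl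
  have c1 : ∀ a b c e : Fin 5, ![a, b, c, e] 1 = b := fun _ _ _ _ => rfl
  have c2 : ∀ a b c e : Fin 5, ![a, b, c, e] 2 = c := fun _ _ _ _ => rfl
  have c3 : ∀ a b c e : Fin 5, ![a, b, c, e] 3 = e := fun _ _ _ _ => rfl
  simp only [hu0, hu1, hu2, hu3, c0, c1, c2, c3]
  have hji := hτ j i
  have hiu := hτ i u
  have hiv := hτ i v
  have e1 := hE v i j
  have e2 := hE v j i
  have e3 := hE u i j
  have e4 := hE u j i
  simp only [hδ _ _ (_ * _), hδ _ _ (γ _), hsymm i u, hsymm i v, hsymm j u, hsymm j v, hji, hiu, hiv]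
    at e1 e2 e3 e4 ⊢
  generalize (if u = i then (1 : ℝ) else 0) = δui at *
  generalize (if u = j then (1 : ℝ) else 0) = δuj at *
  generalize (if u = k then (1 : ℝ) else 0) = δuk at *
  generalize (if u = l then (1 : ℝ) else 0) = δul at *
  generalize (if v = i then (1 : ℝ) else 0) = δvi at *
  generalize (if v = j then (1 : ℝ) else 0) = δvj at *
  generalize (if v = k then (1 : ℝ) else 0) = δvk at *
  generalize (if v = l then (1 : ℝ) else 0) = δvl at *
  generalize (if j = k then (1 : ℝ) else 0) = δjk at *
  generalize (if j = l then (1 : ℝ) else 0) = δjl at *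
  generalize (if i = k then (1 : ℝ) else 0) = δik at *
  generalize (if i = l then (1 : ℝ) else 0) = δil at *
  linear_combination (d u v * s u * γ u * (δuk * γ i * δil - δul * γ i * δik)) * e2
    + (d u v * s u * γ u * (δul * γ j * δjk - δuk * γ j * δjl)) * e1
    - (d u v * s v * γ v * (δvk * γ i * δil - δvl * γ i * δik)) * e4
    - (d u v * s v * γ v * (δvl * γ j * δjk - δvk * γ j * δjl)) * e3

/-! ### The curvature operator of the interior metric -/

/-- The curvature components in terms of the tables. -/
noncomputable def curvTable (h p q t θ φ : ℝ) (u v l i : Fin 5) : ℝ :=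
  christoffelDerivTable h p q t θ φ u l v i - christoffelDerivTable h p q t θ φ v l u i
    + ∑ m, (christoffelTable h p t θ φ m v i * christoffelTable h p t θ φ l u m
        - christoffelTable h p t θ φ m u i * christoffelTable h p t θ φ l v m)

theorem curvTable_swap (h p q t θ φ : ℝ) (u v l i : Fin 5) :
    curvTable h p q t θ φ u v l i = -curvTable h p q t θ φ v u l i := by
  unfold curvTable
  rw [neg_add, neg_sub, ← Finset.sum_neg_distrib]
  simp only [neg_sub]

/-- The diagonal metric entries in terms of the lapse. -/
noncomputable def metricTable (h t θ φ : ℝ) : Fin 5 → ℝ :=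
  ![-h⁻¹, h, t ^ 2, t ^ 2 * Real.sin θ ^ 2, t ^ 2 * (Real.sin θ ^ 2 * Real.sin φ ^ 2)]

theorem blockVal_comm (a b c : ℝ) (i j : Fin 5) : blockVal a b c i j = blockVal a b c j i := by
  unfold blockVal
  split_ifs <;> rfl

theorem blockOp_swap (γ : Fin 5 → ℝ) (a b c : ℝ) (u v l i : Fin 5) :
    blockOp γ a b c u v l i = -blockOp γ a b c v u l i := by
  simp only [blockOp, Matrix.smul_apply, wedgeEnd_diagonal, smul_eq_mul, blockVal_comm a b c u v]
  ring

-- By antisymmetry in the first two indices only pairs `u < v` need checking; this case and the next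
-- three treat them by the value of `u`.
set_option maxHeartbeats 2000000 in
theorem curvTable_time {h t θ φ : ℝ} (p q : ℝ) (hh : h ≠ 0) (ht : t ≠ 0)
    (hθ : Real.sin θ ≠ 0) (hφ : Real.sin φ ≠ 0) (v l i : Fin 5) (huv : 0 < v) :
    curvTable h p q t θ φ 0 v l i =
      blockOp (metricTable h t θ φ) (q / 2) (p / (2 * t)) ((1 + h) / t ^ 2) 0 v l i := by
  simp only [blockOp, Matrix.smul_apply, wedgeEnd_diagonal, curvTable, Fin.sum_univ_five]
  have d0 : christoffelDerivTable h p q t θ φ 0 = christoffelDerivT h p q t θ φ := rfl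
  have d1 : christoffelDerivTable h p q t θ φ 1 = 0 := rfl
  have d2 : christoffelDerivTable h p q t θ φ 2 = christoffelDerivTheta h t θ φ := rfl
  have d3 : christoffelDerivTable h p q t θ φ 3 = christoffelDerivPhi h t θ φ := rfl
  have d4 : christoffelDerivTable h p q t θ φ 4 = 0 := rfl
  fin_cases v
  · exact absurd huv (by decide)
  · simp [d0, d1]
    fin_cases l <;> fin_cases i <;>
      simp [christoffelDerivT, christoffelTable, metricTable, blockVal] <;>
      (try field_simp) <;> (try ring)
  · simp [d0, d2]
    fin_cases l <;> fin_cases i <;>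
      simp [christoffelDerivT, christoffelDerivTheta, christoffelTable, metricTable, blockVal] <;>
      (try field_simp) <;> (try ring)
  · simp [d0, d3]
    fin_cases l <;> fin_cases i <;>
      simp [christoffelDerivT, christoffelDerivPhi, christoffelTable, metricTable, blockVal] <;>
      (try field_simp) <;> (try ring)
  · simp [d0, d4]
    fin_cases l <;> fin_cases i <;>
      simp [christoffelDerivT, christoffelTable, metricTable, blockVal] <;>
      (try field_simp) <;> (try ring)

set_option maxHeartbeats 2000000 in
theorem curvTable_z {h t θ φ : ℝ} (p q : ℝ) (hh : h ≠ 0) (ht : t ≠ 0)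
    (hθ : Real.sin θ ≠ 0) (hφ : Real.sin φ ≠ 0) (v l i : Fin 5) (huv : 1 < v) :
    curvTable h p q t θ φ 1 v l i =
      blockOp (metricTable h t θ φ) (q / 2) (p / (2 * t)) ((1 + h) / t ^ 2) 1 v l i := by
  simp only [blockOp, Matrix.smul_apply, wedgeEnd_diagonal, curvTable, Fin.sum_univ_five]
  have d1 : christoffelDerivTable h p q t θ φ 1 = 0 := rfl
  have d2 : christoffelDerivTable h p q t θ φ 2 = christoffelDerivTheta h t θ φ := rfl
  have d3 : christoffelDerivTable h p q t θ φ 3 = christoffelDerivPhi h t θ φ := rfl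
  have d4 : christoffelDerivTable h p q t θ φ 4 = 0 := rfl
  fin_cases v
  · exact absurd huv (by decide)
  · exact absurd huv (by decide)
  · simp [d1, d2]
    fin_cases l <;> fin_cases i <;>
      simp [christoffelDerivTheta, christoffelTable, metricTable, blockVal] <;>
      (try field_simp)
  · simp [d1, d3]
    fin_cases l <;> fin_cases i <;>
      simp [christoffelDerivPhi, christoffelTable, metricTable, blockVal] <;>
      (try field_simp)
  · simp [d1, d4]
    fin_cases l <;> fin_cases i <;>
      simp [christoffelTable, metricTable, blockVal] <;> try field_simp

-- Both indices are now on the sphere. The identity `cos² = 1 - sin²` supplies the intrinsic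
-- curvature of the unit sphere, the `1` in `(1 + h) / t ^ 2`.
set_option maxHeartbeats 2000000 in
theorem curvTable_theta {h t θ φ : ℝ} (p q : ℝ) (ht : t ≠ 0)
    (hθ : Real.sin θ ≠ 0) (hφ : Real.sin φ ≠ 0) (v l i : Fin 5) (huv : 2 < v) :
    curvTable h p q t θ φ 2 v l i =
      blockOp (metricTable h t θ φ) (q / 2) (p / (2 * t)) ((1 + h) / t ^ 2) 2 v l i := by
  simp only [blockOp, Matrix.smul_apply, wedgeEnd_diagonal, curvTable, Fin.sum_univ_five]
  have h2 := Real.cos_sq' θ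
  have d2 : christoffelDerivTable h p q t θ φ 2 = christoffelDerivTheta h t θ φ := rfl
  have d3 : christoffelDerivTable h p q t θ φ 3 = christoffelDerivPhi h t θ φ := rfl
  have d4 : christoffelDerivTable h p q t θ φ 4 = 0 := rfl
  fin_cases v
  · exact absurd huv (by decide)
  · exact absurd huv (by decide)
  · exact absurd huv (by decide)
  · simp [d2, d3]
    fin_cases l <;> fin_cases i <;>
      simp [christoffelDerivTheta, christoffelDerivPhi, christoffelTable, metricTable, blockVal] <;>
      (try field_simp) <;> (try simp only [h2]) <;> (try ring)
  · simp [d2, d4]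
    fin_cases l <;> fin_cases i <;>
      simp [christoffelDerivTheta, christoffelTable, metricTable, blockVal] <;>
      (try field_simp) <;> (try simp only [h2]) <;> (try ring)

set_option maxHeartbeats 2000000 in
theorem curvTable_phi {h t θ φ : ℝ} (p q : ℝ) (ht : t ≠ 0)
    (hθ : Real.sin θ ≠ 0) (hφ : Real.sin φ ≠ 0) (v l i : Fin 5) (huv : 3 < v) :
    curvTable h p q t θ φ 3 v l i =
      blockOp (metricTable h t θ φ) (q / 2) (p / (2 * t)) ((1 + h) / t ^ 2) 3 v l i := by
  simp only [blockOp, Matrix.smul_apply, wedgeEnd_diagonal, curvTable, Fin.sum_univ_five]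
  have h2 := Real.cos_sq' θ
  have h3 := Real.cos_sq' φ
  have d3 : christoffelDerivTable h p q t θ φ 3 = christoffelDerivPhi h t θ φ := rfl
  have d4 : christoffelDerivTable h p q t θ φ 4 = 0 := rfl
  fin_cases v
  · exact absurd huv (by decide)
  · exact absurd huv (by decide)
  · exact absurd huv (by decide)
  · exact absurd huv (by decide)
  · simp [d3, d4]
    fin_cases l <;> fin_cases i <;>
      simp [christoffelDerivPhi, christoffelTable, metricTable, blockVal] <;>
      (try field_simp) <;> (try simp only [h2, h3]) <;> (try ring)

theorem curvOp_interiorMetric {J : Set ℝ} (hJ : IsOpen J) {ξ : ℝ → ℝ} (hξ : ContDiffOn ℝ 2 ξ J)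
    {x : Coord 5} (hxJ : x 0 ∈ J) (ht : x 0 ≠ 0) (hl : lapse ξ (x 0) ≠ 0)
    (hθ : Real.sin (x 2) ≠ 0) (hφ : Real.sin (x 3) ≠ 0) :
    curvOp (interiorMetric ξ) x = blockOp (metricDiag ξ x) (lapse'' ξ (x 0) / 2)
      (lapse' ξ (x 0) / (2 * x 0)) ((1 + lapse ξ (x 0)) / x 0 ^ 2) := by
  have hdiff : ∀ s ∈ J, DifferentiableAt ℝ ξ s := fun s hs =>
    (hξ.contDiffAt (hJ.mem_nhds hs)).differentiableAt (by norm_num)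
  have hdiff' : DifferentiableAt ℝ (deriv ξ) (x 0) :=
    ((hξ.contDiffAt (hJ.mem_nhds hxJ)).derivWithin (m := 1) (by norm_num)).differentiableAt
      (by norm_num)
  -- The curvature differentiates the Christoffel symbols, so the nondegeneracy conditions are
  -- needed on a neighbourhood of `x`; they are open conditions.
  have hreg : ∀ᶠ y : Coord 5 in nhds x, y 0 ∈ J ∧ y 0 ≠ 0 ∧ lapse ξ (y 0) ≠ 0 ∧
      Real.sin (y 2) ≠ 0 ∧ Real.sin (y 3) ≠ 0 := by
    have h0 : Filter.Tendsto (fun y : Coord 5 => y 0) (nhds x) (nhds (x 0)) :=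
      (continuous_apply 0).tendsto x
    have hL : ContinuousAt (lapse ξ) (x 0) :=
      (hasDerivAt_lapse (hdiff _ hxJ) ht).continuousAt
    have h2 : ContinuousAt (fun y : Coord 5 => Real.sin (y 2)) x :=
      (Real.continuous_sin.comp (continuous_apply 2)).continuousAt
    have h3 : ContinuousAt (fun y : Coord 5 => Real.sin (y 3)) x :=
      (Real.continuous_sin.comp (continuous_apply 3)).continuousAt
    filter_upwards [h0.eventually (hJ.mem_nhds hxJ), h0.eventually_ne ht,
      (hL.tendsto.comp h0).eventually_ne hl, h2.eventually_ne hθ, h3.eventually_ne hφ]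
      with y a b c d e using ⟨a, b, c, d, e⟩
  have hΓ : ∀ l i j, christoffel (interiorMetric ξ) l i j =ᶠ[nhds x] fun y =>
      christoffelTable (lapse ξ (y 0)) (lapse' ξ (y 0)) (y 0) (y 2) (y 3) l i j := by
    intro l i j
    filter_upwards [hreg] with y hy
    exact christoffel_interiorMetric (hdiff _ hy.1) hy.2.1 hy.2.2.1 hy.2.2.2.1 hy.2.2.2.2 l i j
  have hdΓ : ∀ u l i j, partialDeriv u (christoffel (interiorMetric ξ) l i j) x =
      christoffelDerivTable (lapse ξ (x 0)) (lapse' ξ (x 0)) (lapse'' ξ (x 0)) (x 0) (x 2) (x 3)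
        u l i j := fun u l i j => by
    rw [partialDeriv_congr (hΓ l i j) u]
    exact partialDeriv_christoffelTable (hdiff _ hxJ) hdiff' ht hl hθ hφ u l i j
  funext u v
  ext l i
  have hcurv : curvOp (interiorMetric ξ) x u v l i =
      curvTable (lapse ξ (x 0)) (lapse' ξ (x 0)) (lapse'' ξ (x 0)) (x 0) (x 2) (x 3) u v l i := by
    simp only [curvOp, curvTable, hdΓ, (hΓ _ _ _).eq_of_nhds]
  rw [hcurv]
  have key : ∀ u v : Fin 5, u < v →
      curvTable (lapse ξ (x 0)) (lapse' ξ (x 0)) (lapse'' ξ (x 0)) (x 0) (x 2) (x 3) u v l i =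
        blockOp (metricDiag ξ x) (lapse'' ξ (x 0) / 2)
          (lapse' ξ (x 0) / (2 * x 0)) ((1 + lapse ξ (x 0)) / x 0 ^ 2) u v l i := by
    intro u v huv
    fin_cases u
    -- At these arguments `metricTable` is definitionally `metricDiag ξ x`.
    · exact curvTable_time _ _ hl ht hθ hφ v l i huv
    · exact curvTable_z _ _ hl ht hθ hφ v l i huv
    · exact curvTable_theta _ _ ht hθ hφ v l i huv
    · exact curvTable_phi _ _ ht hθ hφ v l i huv
    · exact absurd huv (not_lt_of_ge (Fin.le_last v))
  rcases lt_trichotomy u v with huv | rfl | huv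
  · exact key u v huv
  · have h1 := curvTable_swap (lapse ξ (x 0)) (lapse' ξ (x 0)) (lapse'' ξ (x 0)) (x 0) (x 2) (x 3)
      u u l i
    have h2 := blockOp_swap (metricDiag ξ x) (lapse'' ξ (x 0) / 2)
      (lapse' ξ (x 0) / (2 * x 0)) ((1 + lapse ξ (x 0)) / x 0 ^ 2) u u l i
    linarith
  · rw [curvTable_swap, blockOp_swap, key v u huv]

/-! ### Ricci tensor and derived curvature operators of a block operator -/

theorem lower_blockOp (γ : Fin 5 → ℝ) (a b c : ℝ) (I : Fin 4 → Fin 5) :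
    lower (Matrix.diagonal γ) (blockOp γ a b c) I = blockVal a b c (I 0) (I 1) *
      ((if I 1 = I 2 then γ (I 1) else 0) * (if I 0 = I 3 then γ (I 0) else 0)
        - (if I 0 = I 2 then γ (I 0) else 0) * (if I 1 = I 3 then γ (I 1) else 0)) :=
  lower_wedgeEnd _ _ _

theorem blockOp_apply (γ : Fin 5 → ℝ) (a b c : ℝ) (u v p i : Fin 5) :
    blockOp γ a b c u v p i = blockVal a b c u v *
      ((if v = i then γ v else 0) * (if p = u then 1 else 0)
        - (if u = i then γ u else 0) * (if p = v then 1 else 0)) := by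
  simp only [blockOp, Matrix.smul_apply, wedgeEnd_diagonal, smul_eq_mul]

theorem smul_blockOp (γ : Fin 5 → ℝ) (k a b c : ℝ) :
    k • blockOp γ a b c = blockOp γ (k * a) (k * b) (k * c) := by
  funext u v
  ext p i
  simp only [Pi.smul_apply, Matrix.smul_apply, blockOp_apply, smul_eq_mul, ← mul_assoc]
  congr 1
  unfold blockVal
  split_ifs <;> rfl

theorem diagonal_eq_blockForm (γ : Fin 5 → ℝ) : Matrix.diagonal γ = blockForm γ 1 1 := by
  simp [blockForm]

/-- A base direction meets one other base direction and three fibre directions; a fibre direction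
meets two of each kind. -/
theorem ricci_blockOp (γ : Fin 5 → ℝ) (a b c : ℝ) :
    ricci (blockOp γ a b c) = blockForm γ (a + 3 * b) (2 * b + 2 * c) := by
  ext i j
  simp only [ricci, blockOp_apply, blockForm, Fin.sum_univ_five]
  fin_cases i <;> fin_cases j <;> simp [blockVal] <;> ring

theorem ricciOp_blockOp {γ : Fin 5 → ℝ} (hγ : ∀ i, γ i ≠ 0) (a b c : ℝ) :
    ricciOp (Matrix.diagonal γ) (blockOp γ a b c) =
      Matrix.diagonal fun i => if i < 2 then a + 3 * b else 2 * b + 2 * c := by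
  have hinv := inv_diagonal hγ
  ext l i
  simp only [ricciOp, hinv, ricci_blockOp, blockForm]
  by_cases h : l = i
  · subst h
    rw [Finset.sum_eq_single l]
    · simp only [Matrix.diagonal_apply_eq]
      field_simp [hγ l]
    · intro m _ hm
      rw [Matrix.diagonal_apply_ne _ (Ne.symm hm), zero_mul]
    · simp
  · rw [Matrix.diagonal_apply_ne _ h]
    refine Finset.sum_eq_zero fun m _ => ?_
    by_cases hm : l = m
    · subst hm
      rw [Matrix.diagonal_apply_ne _ (Ne.symm h), mul_zero]
    · rw [Matrix.diagonal_apply_ne _ hm, zero_mul]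

theorem scalarCurv_blockOp {γ : Fin 5 → ℝ} (hγ : ∀ i, γ i ≠ 0) (a b c : ℝ) :
    scalarCurv (Matrix.diagonal γ) (blockOp γ a b c) = 2 * a + 12 * b + 6 * c := by
  rw [scalarCurv, ricciOp_blockOp hγ, Matrix.trace_diagonal, Fin.sum_univ_five]
  simp
  ring

theorem diagonal_mulVec_basisVec (s : Fin 5 → ℝ) (u : Fin 5) :
    (Matrix.diagonal s).mulVec (basisVec u) = s u • basisVec u := by
  ext i
  simp only [Matrix.mulVec_diagonal, basisVec, Pi.smul_apply, smul_eq_mul, Pi.single_apply]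
  split_ifs with h
  · rw [h]
  · simp

theorem wedgeEnd_smul_left (A : Matrix (Fin 5) (Fin 5) ℝ) (k : ℝ) (X Y : Fin 5 → ℝ) :
    wedgeEnd A (k • X) Y = k • wedgeEnd A X Y := by
  ext l i
  simp only [wedgeEnd, Matrix.smul_apply, Pi.smul_apply, smul_eq_mul, mul_assoc, ← Finset.mul_sum]
  ring

theorem wedgeEnd_smul_right (A : Matrix (Fin 5) (Fin 5) ℝ) (k : ℝ) (X Y : Fin 5 → ℝ) :
    wedgeEnd A X (k • Y) = k • wedgeEnd A X Y := by
  ext l i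
  simp only [wedgeEnd, Matrix.smul_apply, Pi.smul_apply, smul_eq_mul, mul_assoc, ← Finset.mul_sum]
  ring

theorem conharmonicOp_blockOp {γ : Fin 5 → ℝ} (hγ : ∀ i, γ i ≠ 0) (a b c : ℝ) :
    conharmonicOp (Matrix.diagonal γ) (blockOp γ a b c) =
      blockOp γ (a - 2 / 3 * (a + 3 * b)) (b - 1 / 3 * (a + 5 * b + 2 * c))
        (c - 2 / 3 * (2 * b + 2 * c)) := by
  funext u v
  simp only [conharmonicOp, ricciOp_blockOp hγ, diagonal_mulVec_basisVec, wedgeEnd_smul_left,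
    wedgeEnd_smul_right, blockOp, ← add_smul, smul_smul, ← sub_smul]
  congr 1
  unfold blockVal
  split_ifs <;> push_cast <;> ring

/-- Vanishing Ricci trace forces `a + 3b = 0` and `b + c = 0`, so the Weyl part lies on the line
spanned by `(3, -1, 1)`. Its coefficient `(a - 2b + c)/6` is, up to `ε`, the function `N2` of the
theorem. -/
theorem conformalOp_blockOp {γ : Fin 5 → ℝ} (hγ : ∀ i, γ i ≠ 0) (a b c : ℝ) :
    conformalOp (Matrix.diagonal γ) (blockOp γ a b c) =
      blockOp γ ((a - 2 * b + c) / 2) (-(a - 2 * b + c) / 6) ((a - 2 * b + c) / 6) := by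
  funext u v
  simp only [conformalOp, ricciOp_blockOp hγ, scalarCurv_blockOp hγ, diagonal_mulVec_basisVec,
    wedgeEnd_smul_left, wedgeEnd_smul_right, blockOp, ← add_smul, smul_smul, ← sub_smul]
  congr 1
  unfold blockVal
  split_ifs <;> push_cast <;> ring

theorem concircularOp_blockOp {γ : Fin 5 → ℝ} (hγ : ∀ i, γ i ≠ 0) (a b c : ℝ) :
    concircularOp (Matrix.diagonal γ) (blockOp γ a b c) =
      blockOp γ (a - (a + 6 * b + 3 * c) / 10) (b - (a + 6 * b + 3 * c) / 10)
        (c - (a + 6 * b + 3 * c) / 10) := by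
  funext u v
  simp only [concircularOp, scalarCurv_blockOp hγ, blockOp, ← sub_smul]
  congr 1
  unfold blockVal
  split_ifs <;> push_cast <;> ring

theorem tensorG_diagonal (γ : Fin 5 → ℝ) :
    tensorG (Matrix.diagonal γ) = lower (Matrix.diagonal γ) (blockOp γ 1 1 1) := by
  have : blockOp γ 1 1 1 = fun u v =>
      wedgeEnd (Matrix.diagonal γ) (basisVec u) (basisVec v) := by
    funext u v
    simp [blockOp, blockVal]
  rw [this, tensorG]

/-- For diagonal forms the product has value `s_i r_j + s_j r_i` on the pair `(i, j)`. -/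
theorem kulkarniNomizu_blockForm (γ : Fin 5 → ℝ) (s s' r r' : ℝ) :
    kulkarniNomizu (blockForm γ s s') (blockForm γ r r') =
      lower (Matrix.diagonal γ) (blockOp γ (2 * s * r) (s * r' + s' * r) (2 * s' * r')) := by
  have hB : ∀ (s s' : ℝ) (i j : Fin 5), blockForm γ s s' i j =
      (if i < 2 then s else s') * if i = j then γ i else 0 := by
    intro s s' i j
    simp [blockForm, Matrix.diagonal]
  have hV : blockVal (2 * s * r) (s * r' + s' * r) (2 * s' * r') = fun i j =>
      (if i < 2 then s else s') * (if j < 2 then r else r')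
        + (if j < 2 then s else s') * (if i < 2 then r else r') := by
    funext i j
    unfold blockVal
    split_ifs <;> ring
  funext I
  rw [lower_blockOp, hV]
  simp only [kulkarniNomizu, hB]
  ring

/-! ### Reduction of all actions to two fixed tensors -/

/-- The sign of the ordered pair `(u, v)` if it joins the two blocks, and `0` otherwise. -/
def crossSign (u v : Fin 5) : ℝ :=
  if u < 2 then (if v < 2 then 0 else 1) else (if v < 2 then -1 else 0)

/-- The tensor `D · T` pattern whose repeated index lies in `{0, 1}`. -/
def mixedLow (γ : Fin 5 → ℝ) (I : Fin 4 → Fin 5) (u v : Fin 5) : ℝ :=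
  mixedTensor (fun w => if w < 2 then crossSign u v * (γ u * γ v * γ w) else 0) I u v

/-- The tensor `D · T` pattern whose repeated index lies in `{2, 3, 4}`. -/
def mixedHigh (γ : Fin 5 → ℝ) (I : Fin 4 → Fin 5) (u v : Fin 5) : ℝ :=
  mixedTensor (fun w => if w < 2 then 0 else crossSign u v * (γ u * γ v * γ w)) I u v

theorem mixedTensor_add_smul (α β : ℝ) (X Y : Fin 5 → ℝ) (I : Fin 4 → Fin 5) (u v : Fin 5) :
    mixedTensor (fun w => α * X w + β * Y w) I u v =
      α * mixedTensor X I u v + β * mixedTensor Y I u v := by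
  have h : ∀ (P : Prop) [Decidable P] (w : Fin 5), (if P then α * X w + β * Y w else 0) =
      α * (if P then X w else 0) + β * (if P then Y w else 0) := by
    intro P _ w
    split_ifs <;> simp
  simp only [mixedTensor, h]
  ring

/-- If `u` and `v` lie in one block, then `τ v w = τ u w` and the difference in `dot_lower`
vanishes. For a mixed pair the acting operator enters only through `b`, and the difference is `b' -
a'` or `c' - b'` up to sign, according to the block of `w`. -/
theorem dot_blockOp (γ : Fin 5 → ℝ) (a b c a' b' c' : ℝ) :
    dot (blockOp γ a b c) (lower (Matrix.diagonal γ) (blockOp γ a' b' c')) =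
      (b * (b' - a')) • mixedLow γ + (b * (c' - b')) • mixedHigh γ := by
  funext I u v
  have h := dot_lower (blockVal a b c) (blockVal a' b' c') (blockVal_comm a' b' c')
    (fun _ => 1) γ I u v
  simp only [one_mul] at h
  refine h.trans ?_
  simp only [Pi.add_apply, Pi.smul_apply, smul_eq_mul, mixedLow, mixedHigh,
    ← mixedTensor_add_smul]
  congr 1
  funext w
  unfold blockVal crossSign
  split_ifs <;> ring

theorem tachibana_blockForm (γ : Fin 5 → ℝ) (s s' a' b' c' : ℝ) :
    tachibana (blockForm γ s s') (lower (Matrix.diagonal γ) (blockOp γ a' b' c')) =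
      (s * b' - s' * a') • mixedLow γ + (s * c' - s' * b') • mixedHigh γ := by
  funext I u v
  have h := dot_lower (fun _ _ => 1) (blockVal a' b' c') (blockVal_comm a' b' c')
    (fun i => if i < 2 then s else s') γ I u v
  simp only [one_smul] at h
  refine h.trans ?_
  simp only [Pi.add_apply, Pi.smul_apply, smul_eq_mul, mixedLow, mixedHigh,
    ← mixedTensor_add_smul]
  congr 1
  funext w
  unfold blockVal crossSign
  split_ifs <;> ring

/-- The projective curvature operator acts on the Ricci tensor as the curvature operator does. -/
theorem dot_projectiveOp_diagonal (D : BiEnd 5) (s : Fin 5 → ℝ) (hs : ricci D = Matrix.diagonal s) :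
    dot (projectiveOp D) (ofMatrix (Matrix.diagonal s)) =
      dot D (ofMatrix (Matrix.diagonal s)) := by
  funext I u v
  have h := dot_wedgeEnd (fun _ _ => 1) s (ofMatrix (Matrix.diagonal s)) I u v
  -- This is `Q(S, S) = 0`: the two slots contribute opposite terms because `S` is symmetric. The
  -- correction `X ∧_S Y` in the projective operator therefore does not act on `S`.
  have h0 : ∑ a, ((if u = I a then s u else 0) *
      ofMatrix (Matrix.diagonal s) (Function.update I a v)
        - (if v = I a then s v else 0) *
      ofMatrix (Matrix.diagonal s) (Function.update I a u)) = 0 := by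
    simp only [Fin.sum_univ_two, ofMatrix, Matrix.diagonal_apply, Function.update_apply]
    simp
    generalize I 0 = i
    generalize I 1 = j
    grind
  rw [h0, mul_zero] at h
  simp only [one_smul, dot, neg_eq_zero] at h
  simp only [dot, projectiveOp, hs, Matrix.sub_apply, Matrix.smul_apply, smul_eq_mul, sub_mul,
    Finset.sum_sub_distrib, mul_assoc, ← Finset.mul_sum, h]
  simp

/-! ### From scalar identities to tensor identities -/

section Combination

variable {α₁ α₂ α₃ β₁ β₂ β₃ k₁ k₂ k₃ : ℝ}
  {A B : (Fin 4 → Fin 5) → Fin 5 → Fin 5 → ℝ}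

/-- Here and in the variants below, `A` and `B` stand for `mixedLow` and `mixedHigh`. Comparing
coefficients is sufficient, so their linear independence plays no role. -/
theorem sub_eq_smul_comb (h : α₁ - α₂ = k₃ * α₃) (h' : β₁ - β₂ = k₃ * β₃) :
    (α₁ • A + β₁ • B) - (α₂ • A + β₂ • B) = k₃ • (α₃ • A + β₃ • B) := by
  linear_combination (norm := module) h • A + h' • B

theorem add_add_eq_zero_comb (h : k₁ * α₁ + k₂ * α₂ + k₃ * α₃ = 0)
    (h' : k₁ * β₁ + k₂ * β₂ + k₃ * β₃ = 0) :
    k₁ • (α₁ • A + β₁ • B) + k₂ • (α₂ • A + β₂ • B) + k₃ • (α₃ • A + β₃ • B) = 0 := by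
  linear_combination (norm := module) h • A + h' • B

theorem sub_add_eq_zero_comb (h : k₁ * α₁ - k₂ * α₂ + k₃ * α₃ = 0)
    (h' : k₁ * β₁ - k₂ * β₂ + k₃ * β₃ = 0) :
    k₁ • (α₁ • A + β₁ • B) - k₂ • (α₂ • A + β₂ • B) + k₃ • (α₃ • A + β₃ • B) = 0 := by
  linear_combination (norm := module) h • A + h' • B

theorem smul_sub_eq_comb (h : k₁ * α₁ - k₂ * α₂ = k₃ * α₃)
    (h' : k₁ * β₁ - k₂ * β₂ = k₃ * β₃) :
    k₁ • (α₁ • A + β₁ • B) - k₂ • (α₂ • A + β₂ • B) = k₃ • (α₃ • A + β₃ • B) := by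
  linear_combination (norm := module) h • A + h' • B

theorem smul_add_eq_comb (h : k₁ * α₁ + k₂ * α₂ = k₃ * α₃)
    (h' : k₁ * β₁ + k₂ * β₂ = k₃ * β₃) :
    k₁ • (α₁ • A + β₁ • B) + k₂ • (α₂ • A + β₂ • B) = k₃ • (α₃ • A + β₃ • B) := by
  linear_combination (norm := module) h • A + h' • B

end Combination

theorem lower_comb (γ : Fin 5 → ℝ) (k₁ k₂ k₃ a₁ a₂ a₃ b₁ b₂ b₃ c₁ c₂ c₃ : ℝ) :
    k₁ • lower (Matrix.diagonal γ) (blockOp γ a₁ b₁ c₁)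
        + k₂ • lower (Matrix.diagonal γ) (blockOp γ a₂ b₂ c₂)
        + k₃ • lower (Matrix.diagonal γ) (blockOp γ a₃ b₃ c₃) =
      lower (Matrix.diagonal γ) (blockOp γ (k₁ * a₁ + k₂ * a₂ + k₃ * a₃)
        (k₁ * b₁ + k₂ * b₂ + k₃ * b₃) (k₁ * c₁ + k₂ * c₂ + k₃ * c₃)) := by
  funext I
  simp only [Pi.add_apply, Pi.smul_apply, smul_eq_mul, lower_blockOp, ← mul_assoc, ← add_mul]
  congr 1
  unfold blockVal
  split_ifs <;> rfl

end InteriorBH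

/-! ### The fourteen identities -/

open InteriorBH in
set_option maxHeartbeats 2000000 in
theorem theorem4p4
    -- the sign convention for the curvature operator, `ε ([∇_X, ∇_Y] - ∇_{[X,Y]})`
    (ε : ℝ) (hε : ε = 1 ∨ ε = -1)
    (J : Set ℝ) (hJ : IsOpen J) (ξ : ℝ → ℝ) (hξ : ContDiffOn ℝ 2 ξ J)
    (x : Coord 5) (hxJ : x 0 ∈ J) (ht : x 0 ≠ 0) (hh : 2 * ξ (x 0) ≠ (x 0) ^ 2)
    (hθ : Real.sin (x 2) ≠ 0) (hφ : Real.sin (x 3) ≠ 0) :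
    let t : ℝ := x 0
    let f : ℝ := ξ t
    let f₁ : ℝ := deriv ξ t
    let f₂ : ℝ := deriv (deriv ξ) t
    -- the metric, the curvature operators and the curvature tensors at the point `x`
    let g : Matrix (Fin 5) (Fin 5) ℝ := interiorMetric ξ x
    let opR : BiEnd 5 := ε • curvOp (interiorMetric ξ) x
    let opC : BiEnd 5 := conformalOp g opR
    let opP : BiEnd 5 := projectiveOp opR
    let opW : BiEnd 5 := concircularOp g opR
    let opK : BiEnd 5 := conharmonicOp g opR
    let S : Matrix (Fin 5) (Fin 5) ℝ := ricci opR
    let R : CovTensor 5 4 := lower g opR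
    let C : CovTensor 5 4 := lower g opC
    let W : CovTensor 5 4 := lower g opW
    let K : CovTensor 5 4 := lower g opK
    let G : CovTensor 5 4 := tensorG g
    -- the coefficients
    let N1 : ℝ := (2 * f - t * f₁) / t ^ 4
    let N2 : ℝ := (12 * f - 6 * t * f₁ + t ^ 2 * f₂) / (6 * t ^ 4)
    let N3 : ℝ := (20 * f - 8 * t * f₁ + t ^ 2 * f₂) / (10 * t ^ 4)
    let N4 : ℝ := (6 * f - 2 * t * f₁ + t ^ 2 * f₂) / (3 * t ^ 4)
    let N5 : ℝ := -((2 * f₁ + t * f₂) / (10 * t ^ 3))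
    let N6 : ℝ := -((2 * f₁ + t * f₂) / (6 * t ^ 3))
    let N7 : ℝ := (4 * f + t ^ 2 * f₂) / (2 * t ^ 4)
    let N8 : ℝ := 3 * (8 * f ^ 2 - 4 * t * f * f₁ - t ^ 2 * f₁ ^ 2 + 2 * t ^ 2 * f * f₂) /
      (t ^ 4 * (12 * f - 6 * t * f₁ + t ^ 2 * f₂))
    let N9 : ℝ := -((3 * f₁ * (4 * f - 3 * t * f₁) + t * f₂ * (4 * f + t * f₁)) / (2 * t ^ 7))
    let N10 : ℝ := (-80 * f ^ 2 + 64 * t * f * f₁ - 2 * t ^ 2 * f₁ ^ 2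
      - 4 * t ^ 2 * f₂ * (2 * f + t * f₁) + t ^ 4 * f₂ ^ 2) / (20 * t ^ 8)
    let N11 : ℝ := (-6 * f + 6 * t * f₁ + t ^ 2 * f₂) / (3 * t ^ 4)
    let N12 : ℝ := (20 * f - 16 * t * f₁ - 3 * t ^ 2 * f₂) / (10 * t ^ 4)
    let N13 : ℝ := (6 * f₁ ^ 2 + 5 * t * f₁ * f₂ + t ^ 2 * f₂ ^ 2) / (6 * t ^ 6)
    let N14 : ℝ := (240 * f ^ 2 - 216 * t * f * f₁ + 48 * t ^ 2 * f₁ ^ 2 + 32 * t ^ 2 * f * f₂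
      - 14 * t ^ 3 * f₁ * f₂ + t ^ 4 * f₂ ^ 2) / (60 * t ^ 8)
    let φ : ℝ := -(t ^ 2 * (12 * f + t * (t * f₂ - 6 * f₁)) / (3 * f₁ - t * f₂) ^ 2)
    let μ : ℝ := -((3 * f₁ * (4 * f - 3 * t * f₁) + t * (4 * f + t * f₁) * f₂) /
      (t * (3 * f₁ - t * f₂) ^ 2))
    let η : ℝ := -(2 * (-6 * t * f₁ ^ 3 + f * (9 * f₁ ^ 2 + 2 * t * f₁ * f₂ + t ^ 2 * f₂ ^ 2)) /
      (t ^ 4 * (3 * f₁ - t * f₂) ^ 2))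
    -- (i)
    dot opR (ofMatrix S) = dot opP (ofMatrix S) ∧
    -- (ii)
    dot opR W - dot opW R = (-ε * N5) • tachibana g R ∧
    -- (iii)
    dot opC K - dot opK C = (-ε * N6) • tachibana g C ∧
    -- (iv)
    dot opC R - tachibana S C = (-ε * N7) • tachibana g C ∧
    -- (v)
    (12 * f - 6 * t * f₁ + t ^ 2 * f₂ ≠ 0 →
      dot opR R - tachibana S R = (-ε * N8) • tachibana g C) ∧
    -- (vi)
    (12 * f - 6 * t * f₁ + t ^ 2 * f₂ ≠ 0 →
      (N5 * N9) • dot opR W + (N1 * N10) • tachibana S R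
        + (N1 * N2 * N8) • tachibana S W = 0) ∧
    -- (vii)
    N4 • dot opR K + N11 • dot opK R + N4 • tachibana S K = 0 ∧
    -- (viii)
    (12 * f - 6 * t * f₁ + t ^ 2 * f₂ ≠ 0 →
      (N2 * N4 * N8) • dot opR K - (N1 ^ 2 * N2) • dot opK R
        + (N1 * N2 * N4) • tachibana S R = 0) ∧
    -- (ix)
    N3 • dot opC W - N7 • dot opW C = N3 • tachibana S C ∧
    -- (x)
    (N3 * N12) • dot opC W + N10 • dot opW C = (N3 * N2) • tachibana S W ∧
    -- (xi)
    N13 • dot opC K + (N2 * N11) • tachibana S C + (N2 ^ 2) • tachibana S K = 0 ∧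
    -- (xii)
    (N4 * N10) • dot opW K + (N12 * N14) • dot opK W = (N4 * N14) • tachibana S W ∧
    -- (xiii)
    (N1 * N4) • dot opW K + (N3 * N11) • dot opK W + (N3 * N4) • tachibana S K = 0 ∧
    -- (xiv)
    (3 * f₁ - t * f₂ ≠ 0 →
      R = (-ε * (φ / 2)) • kulkarniNomizu S S + μ • kulkarniNomizu g S + (-ε * η) • G) := by
  intro t f f₁ f₂ g opR opC opP opW opK S R C W K G
  have ht' : t ≠ 0 := ht
  have hl : lapse ξ (x 0) ≠ 0 := by
    intro h
    apply hh
    unfold lapse at h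
    field_simp at h
    linarith
  have hγ := metricDiag_ne_zero ht hl hθ hφ
  have hg : g = Matrix.diagonal (metricDiag ξ x) := rfl
  have hR : opR = blockOp (metricDiag ξ x) (ε * (f₂ / t ^ 2 - 4 * f₁ / t ^ 3 + 6 * f / t ^ 4))
      (ε * (f₁ / t ^ 3 - 2 * f / t ^ 4)) (ε * (2 * f / t ^ 4)) := by
    have h : opR = ε • curvOp (interiorMetric ξ) x := rfl
    rw [h, curvOp_interiorMetric hJ hξ hxJ ht hl hθ hφ, smul_blockOp]
    congr 2
    · simp only [lapse'', f, f₁, f₂, t]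
      ring
    · simp only [lapse', f, f₁, t]
      field_simp
      ring
    · simp only [lapse, f, t]
      field_simp
      ring
  have hopP : opP = projectiveOp opR := rfl
  have hopC : opC = conformalOp g opR := rfl
  have hopW : opW = concircularOp g opR := rfl
  have hopK : opK = conharmonicOp g opR := rfl
  have hS : S = ricci opR := rfl
  have hTR : R = lower g opR := rfl
  have hTC : C = lower g opC := rfl
  have hTW : W = lower g opW := rfl
  have hTK : K = lower g opK := rfl
  have hTG : G = tensorG g := rfl
  -- The defining equations are now recorded as hypotheses; from here `f`, `f₁`, `f₂`, `t` are
  -- independent real variables and only algebra remains.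
  clear_value opP opC opW opK S R C W K G opR g t f f₁ f₂
  rw [hg, hR, conformalOp_blockOp hγ] at hopC
  rw [hg, hR, concircularOp_blockOp hγ] at hopW
  rw [hg, hR, conharmonicOp_blockOp hγ] at hopK
  rw [hR, ricci_blockOp] at hS
  rw [hg, hR] at hTR
  rw [hg, hopC] at hTC
  rw [hg, hopW] at hTW
  rw [hg, hopK] at hTK
  rw [hg, tensorG_diagonal] at hTG
  rw [diagonal_eq_blockForm] at hg
  have hproj : dot opR (ofMatrix S) = dot opP (ofMatrix S) := by
    rw [hopP, hS, blockForm, dot_projectiveOp_diagonal]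
    rw [hR, ricci_blockOp, blockForm]
  subst hTR hTC hTW hTK hTG hg hS hopC hopW hopK hR
  simp only [dot_blockOp, tachibana_blockForm]
  rw [diagonal_eq_blockForm]
  simp only [kulkarniNomizu_blockForm]
  simp only [← diagonal_eq_blockForm, lower_comb]
  refine ⟨hproj, sub_eq_smul_comb ?_ ?_, sub_eq_smul_comb ?_ ?_, sub_eq_smul_comb ?_ ?_,
    fun h2 => sub_eq_smul_comb ?_ ?_, fun h2 => add_add_eq_zero_comb ?_ ?_,
    add_add_eq_zero_comb ?_ ?_, fun h2 => sub_add_eq_zero_comb ?_ ?_, smul_sub_eq_comb ?_ ?_,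
    smul_add_eq_comb ?_ ?_, add_add_eq_zero_comb ?_ ?_, smul_add_eq_comb ?_ ?_,
    add_add_eq_zero_comb ?_ ?_, fun h3 => ?_⟩
  · rcases hε with rfl | rfl <;> field_simp <;> ring
  · rcases hε with rfl | rfl <;> field_simp <;> ring
  · rcases hε with rfl | rfl <;> field_simp <;> ring
  · rcases hε with rfl | rfl <;> field_simp <;> ring
  · rcases hε with rfl | rfl <;> field_simp <;> ring
  · rcases hε with rfl | rfl <;> field_simp <;> ring
  -- The denominator of `N8`, which vanishes exactly when the Weyl part does, is kept atomic while
  -- fractions are cleared and is expanded only for the final polynomial identity.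
  · generalize hd : 12 * f - 6 * t * f₁ + t ^ 2 * f₂ = d at h2 ⊢
    rcases hε with rfl | rfl <;> field_simp <;> subst hd <;> ring
  · generalize hd : 12 * f - 6 * t * f₁ + t ^ 2 * f₂ = d at h2 ⊢
    rcases hε with rfl | rfl <;> field_simp <;> subst hd <;> ring
  · generalize hd : 12 * f - 6 * t * f₁ + t ^ 2 * f₂ = d at h2 ⊢
    rcases hε with rfl | rfl <;> field_simp <;> subst hd <;> ring
  · generalize hd : 12 * f - 6 * t * f₁ + t ^ 2 * f₂ = d at h2 ⊢
    rcases hε with rfl | rfl <;> field_simp <;> subst hd <;> ring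
  · rcases hε with rfl | rfl <;> field_simp <;> ring
  · rcases hε with rfl | rfl <;> field_simp <;> ring
  · generalize hd : 12 * f - 6 * t * f₁ + t ^ 2 * f₂ = d at h2 ⊢
    rcases hε with rfl | rfl <;> field_simp <;> subst hd <;> ring
  · generalize hd : 12 * f - 6 * t * f₁ + t ^ 2 * f₂ = d at h2 ⊢
    rcases hε with rfl | rfl <;> field_simp <;> subst hd <;> ring
  · rcases hε with rfl | rfl <;> field_simp <;> ring
  · rcases hε with rfl | rfl <;> field_simp <;> ring
  · rcases hε with rfl | rfl <;> field_simp <;> ring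
  · rcases hε with rfl | rfl <;> field_simp <;> ring
  · rcases hε with rfl | rfl <;> field_simp <;> ring
  · rcases hε with rfl | rfl <;> field_simp <;> ring
  · rcases hε with rfl | rfl <;> field_simp <;> ring
  · rcases hε with rfl | rfl <;> field_simp <;> ring
  · rcases hε with rfl | rfl <;> field_simp <;> ring
  · rcases hε with rfl | rfl <;> field_simp <;> ring
  -- Up to the factor `-ε / t ^ 3` this is the difference of the two Ricci eigenvalues. When it is
  -- nonzero, `S ∧ S`, `g ∧ S` and `G` span the three-parameter block family; equality of the values
  -- on the three kinds of pairs remains to be checked.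
  · generalize hd : 3 * f₁ - t * f₂ = d at h3 ⊢
    congr 2
    all_goals
      rcases hε with rfl | rfl <;> field_simp <;> subst hd <;> ring
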